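/- Let $\mathfrak X$ be a countably infinite alphabet containing pairwise distinct letters $x,y,t$ and $z_i,t_i$ ($i\ge 1$). For $n,m\in\mathbb N_0=\{0,1,2,\dots\}$ and a permutation $\rho$ of $\{1,\dots,n+m\}$ (the unique permutation of the empty set if $n+m=0$), let $$\mathbf c_{n,m,0}[\rho]=\Bigl(\prod_{i=1}^n z_it_i\Bigr)\,xyt\,\Bigl(\prod_{i=n+1}^{n+m} z_it_i\Bigr)\,x\,\Bigl(\prod_{i=1}^{n+m} z_{i\rho}\Bigr)\,y ,$$ where $i\rho$ is the image of $i$ under $\rho$ and empty products are the empty word. For a word $\mathbf w$, let $M(\mathbf w)$ be the factor monoid of $\mathbf w$: its elements are all factors (contiguous subwords, including the empty word) of $\mathbf w$ and a zero element $0$; the product of two factors $\mathbf u,\mathbf v$ is the concatenation $\mathbf u\mathbf v$ if this is a factor of $\mathbf w$, and $0$ otherwise; the identity element is the empty word. Let $\mathbf M(\mathbf w)$ be the variety of monoids generated by $M(\mathbf w)$, that is, the smallest class of monoids that contains $M(\mathbf w)$ and is closed under homomorphic images, submonoids and arbitrary direct products. For a variety $\mathbf V$ of monoids, let $\mathfrak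 L(\mathbf V)$ be the lattice of all subvarieties of $\mathbf V$, ordered by inclusion. Proposition. For all $n,m\in\mathbb N_0$ and all permutations $\rho\in S_{n+m}$, the lattice $\mathfrak L(\mathbf M(\mathbf c_{n,m,0}[\rho]))$ is not modular, and so it is not distributive. -/

import Mathlib

/-! ## Varieties of monoids and their lattice -/

/-- A variety of monoids: a class of monoids closed under homomorphic images, submonoids and
arbitrary direct products (the empty product being the trivial monoid). -/
@[ext]
structure MonoidVariety where
  /-- The members of the variety. -/
  carrier : Set MonCat.{0}
  image_mem : ∀ (M N : MonCat.{0}) (f : M →* N), Function.Surjective f →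
    M ∈ carrier → N ∈ carrier
  submonoid_mem : ∀ (M : MonCat.{0}) (S : Submonoid M), M ∈ carrier → MonCat.of S ∈ carrier
  pi_mem : ∀ (ι : Type) (M : ι → MonCat.{0}), (∀ i, M i ∈ carrier) →
    MonCat.of (∀ i, M i) ∈ carrier

namespace MonoidVariety

/-- The intersection of a family of varieties. -/
def inter (F : Set MonoidVariety) : MonoidVariety where
  carrier := {M | ∀ V ∈ F, M ∈ V.carrier}
  image_mem M N f hf hM V hV := V.image_mem M N f hf (hM V hV)
  submonoid_mem M S hM V hV := V.submonoid_mem M S (hM V hV)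
  pi_mem ι M hM V hV := V.pi_mem ι M fun i => hM i V hV

/-- Varieties are ordered by inclusion. -/
instance : PartialOrder MonoidVariety :=
  PartialOrder.lift carrier fun _ _ h => MonoidVariety.ext h

/-- The meet of two varieties is their intersection, and their join is the smallest variety that
contains both. -/
instance : Lattice MonoidVariety where
  inf U V :=
    { carrier := U.carrier ∩ V.carrier
      image_mem := fun M N f hf hM =>
        ⟨U.image_mem M N f hf hM.1, V.image_mem M N f hf hM.2⟩
      submonoid_mem := fun M S hM => ⟨U.submonoid_mem M S hM.1, V.submonoid_mem M S hM.2⟩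
      pi_mem := fun ι M hM =>
        ⟨U.pi_mem ι M fun i => (hM i).1, V.pi_mem ι M fun i => (hM i).2⟩ }
  inf_le_left _ _ _ h := h.1
  inf_le_right _ _ _ h := h.2
  le_inf _ _ _ h₁ h₂ _ h := ⟨h₁ h, h₂ h⟩
  sup U V := inter {W | U ≤ W ∧ V ≤ W}
  le_sup_left _ _ _ h _ hW := hW.1 h
  le_sup_right _ _ _ h _ hW := hW.2 h
  sup_le _ _ W h₁ h₂ _ h := h W ⟨h₁, h₂⟩

/-- The variety generated by a monoid. -/
def generatedBy (M : Type) [Monoid M] : MonoidVariety :=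
  inter {V | MonCat.of M ∈ V.carrier}

/-- The lattice of all subvarieties of `V`. -/
abbrev SubvarietyLattice (V : MonoidVariety) : Type 1 := Set.Iic V

end MonoidVariety

/-! ## Factor monoids -/

/-- The underlying set of the factor monoid `M(w)` of a word `w`: the factors (contiguous subwords)
of `w`, including the empty word, together with a zero element `none`. -/
def FactorMonoid {α : Type} (w : List α) : Type := Option {u : List α // u <:+: w}

namespace FactorMonoid

variable {α : Type} {w : List α}

open Classical in
/-- The class of an arbitrary word: the word itself if it is a factor of `w`, and zero otherwise. -/
noncomputable def ofWord (w u : List α) : FactorMonoid w :=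
  if h : u <:+: w then some ⟨u, h⟩ else none

/-- `u · v` is the concatenation `uv` if this is a factor of `w`, and zero otherwise; zero is
absorbing. -/
noncomputable def mul : FactorMonoid w → FactorMonoid w → FactorMonoid w
  | some u, some v => ofWord w (u.1 ++ v.1)
  | _, _ => none

theorem ofWord_of_not {u : List α} (h : ¬ u <:+: w) : ofWord w u = none := dif_neg h

theorem ofWord_val (u : {u : List α // u <:+: w}) : ofWord w u.1 = some u := dif_pos u.2

theorem none_mul (a : FactorMonoid w) : mul none a = none := by
  cases a <;> rfl

theorem mul_none (a : FactorMonoid w) : mul a none = none := by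
  cases a <;> rfl

theorem ofWord_mul (u v : List α) : mul (ofWord w u) (ofWord w v) = ofWord w (u ++ v) := by
  by_cases hu : u <:+: w
  · by_cases hv : v <:+: w
    · rw [ofWord_val ⟨u, hu⟩, ofWord_val ⟨v, hv⟩]
      rfl
    · rw [ofWord_of_not hv, mul_none, ofWord_of_not]
      exact fun h => hv ((List.suffix_append u v).isInfix.trans h)
  · rw [ofWord_of_not hu, none_mul, ofWord_of_not]
    exact fun h => hu ((List.prefix_append u v).isInfix.trans h)

noncomputable instance : Monoid (FactorMonoid w) where
  mul := mul
  one := ofWord w []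
  mul_assoc a b c := by
    change mul (mul a b) c = mul a (mul b c)
    rcases a with _ | a
    · exact (congrArg (mul · c) (none_mul b)).trans
        ((none_mul c).trans (none_mul (mul b c)).symm)
    rcases b with _ | b
    · exact (none_mul c).trans (congrArg (mul (some a)) (none_mul c)).symm
    rcases c with _ | c
    · exact (mul_none _).trans (congrArg (mul (some a)) (mul_none (some b))).symm
    rw [← ofWord_val a, ← ofWord_val b, ← ofWord_val c]
    simp only [ofWord_mul, List.append_assoc]
  one_mul a := by
    change mul (ofWord w []) a = a
    rcases a with _ | a
    · exact mul_none _
    · rw [← ofWord_val a, ofWord_mul, List.nil_append]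
  mul_one a := by
    change mul a (ofWord w []) = a
    rcases a with _ | a
    · exact none_mul _
    · rw [← ofWord_val a, ofWord_mul, List.append_nil]

end FactorMonoid

/-! ## The words -/

/-- Pairwise distinct letters `x`, `y`, `t`, `z_i`, `t_i`. -/
inductive Letter : Type
  | x : Letter
  | y : Letter
  | t : Letter
  | z : ℕ → Letter
  | ti : ℕ → Letter

open Letter in
/-- The word
`(∏_{i=1}^n z_i t_i) x y t (∏_{i=n+1}^{n+m} z_i t_i) x (∏_{i=1}^{n+m+k} z_{iτ}) y
(∏_{i=n+m+1}^{n+m+k} t_i z_i)`,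
with the indices running from `0` to `n + m + k - 1` instead of from `1` to `n + m + k`. -/
def cWord (n m k : ℕ) (τ : Equiv.Perm (Fin (n + m + k))) : List Letter :=
  (List.range n).flatMap (fun i => [z i, ti i]) ++ [x, y, t] ++
    (List.range' n m).flatMap (fun i => [z i, ti i]) ++ [x] ++
    (List.finRange (n + m + k)).map (fun i => z (τ i).val) ++ [y] ++
    (List.range' (n + m) k).flatMap (fun i => [ti i, z i])

/-! Write `c` for the given word. Four words `w i j` are chosen such that deleting letters turns
them into copies of `c` in two ways, where the first occurrences of `x` and `y` are swapped in the
first copy if `i` is true, and in the second copy if `j` is. Every `w i j` is an isoterm for `M(c)`,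
so the syntactic monoids of `{w₀₀, w₁₀}` and `{w₀₀, w₀₁}` lie in the variety `V` generated by
`M(c)`.

Let `A`, `B`, `C` be the subvarieties of `V` given by the identities `w₀ⱼ ≈ w₁ⱼ` for all `j`,
by `wᵢ₀ ≈ wᵢ₁` for all `i`, and by `w₀₁ ≈ w₁₁` alone. Then `A ≤ C`, and `B ⊓ C` satisfies
`w₀₀ ≈ w₀₁ ≈ w₁₁ ≈ w₁₀`, so `A ⊔ (B ⊓ C)` satisfies `w₀₀ ≈ w₁₀`. The two syntactic monoids lie in
`A` and `B`, and that of the intersection `{w₀₀}` then lies in `(A ⊔ B) ⊓ C`. It does not satisfy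
`w₀₀ ≈ w₁₀`, so the modular law fails.

That these monoids satisfy the required identities rests on an asymmetry of the two copies: a
substitution that maps some `w i j` into some `w i' j'` without erasing the swapped letters of the
first copy fixes those of both copies, and therefore `j = j'`. -/
namespace MonoidVariety

section Identities

variable {X : Type}

/-- The monoid `M` satisfies the identity `u ≈ v`. -/
def Satisfies (M : Type) [Monoid M] (u v : FreeMonoid X) : Prop :=
  ∀ φ : FreeMonoid X →* M, φ u = φ v

/-- The word `w` is an isoterm for `M`: no nontrivial identity `w ≈ v` holds in `M`. -/
def IsIsoterm (M : Type) [Monoid M] (w : FreeMonoid X) : Prop :=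
  ∀ v, Satisfies M w v → v = w

/-- The variety of all monoids that satisfy every identity `e.1 ≈ e.2` with `e ∈ E`. -/
def ofIdentities (E : Set (FreeMonoid X × FreeMonoid X)) : MonoidVariety where
  carrier := {M | ∀ e ∈ E, Satisfies M e.1 e.2}
  image_mem M N f hf hM e he φ := by
    let ψ : FreeMonoid X →* M :=
      FreeMonoid.lift fun i => Function.surjInv hf (φ (FreeMonoid.of i))
    have hφ : φ = f.comp ψ := by
      ext i
      simp [ψ, Function.surjInv_eq hf]
    rw [hφ, MonoidHom.comp_apply, MonoidHom.comp_apply, hM e he ψ]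
  submonoid_mem M S hM e he φ := Subtype.ext (hM e he (S.subtype.comp φ))
  pi_mem ι M hM e he φ := funext fun i => hM i e he ((Pi.evalMonoidHom (fun i => M i) i).comp φ)

/-- The syntactic congruence of the language `T`, which relates `p` and `q` when `T` does not
separate them in any two-sided context. -/
def syntacticCon (T : Set (FreeMonoid X)) : Con (FreeMonoid X) where
  r p q := ∀ l r, l * p * r ∈ T ↔ l * q * r ∈ T
  iseqv :=
    ⟨fun _ _ _ => Iff.rfl, fun h l r => (h l r).symm, fun h k l r => (h l r).trans (k l r)⟩
  mul' {p q p' q'} h k l r := by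
    have hp := h l (p' * r)
    have hq := k (l * q) r
    simp only [mul_assoc] at hp hq ⊢
    exact hp.trans hq

/-- The syntactic monoid of a language. -/
abbrev SyntacticMonoid (T : Set (FreeMonoid X)) : Type := (syntacticCon T).Quotient

variable {S T : Set (FreeMonoid X)} {V : MonoidVariety}

theorem mem_iff_of_syntacticCon {p q : FreeMonoid X} (h : syntacticCon T p q) :
    p ∈ T ↔ q ∈ T := by
  simpa only [one_mul, mul_one] using h 1 1

theorem syntacticMonoid_mem_of_recognizes {N : MonCat.{0}} (hN : N ∈ V.carrier)
    (φ : FreeMonoid X →* N) (h : ∀ p q, φ p = φ q → p ∈ T → q ∈ T) :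
    MonCat.of (SyntacticMonoid T) ∈ V.carrier := by
  have hle : Con.ker φ ≤ syntacticCon T := by
    intro p q (hpq : φ p = φ q) l r
    constructor <;> exact h _ _ (by simp only [map_mul, hpq])
  have hsurj : Function.Surjective (Con.map _ _ hle) := fun a =>
    Con.induction_on a fun p => ⟨(p : (Con.ker φ).Quotient), rfl⟩
  exact V.image_mem (MonCat.of (MonoidHom.mrange φ)) _
    ((Con.map _ _ hle).comp (Con.quotientKerEquivRange φ).symm.toMonoidHom)
    (hsurj.comp (Con.quotientKerEquivRange φ).symm.surjective) (V.submonoid_mem N _ hN)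

theorem syntacticMonoid_mem_generatedBy {M : Type} [Monoid M] (h : ∀ w ∈ T, IsIsoterm M w) :
    MonCat.of (SyntacticMonoid T) ∈ (generatedBy M).carrier := by
  refine syntacticMonoid_mem_of_recognizes
    ((generatedBy M).pi_mem (FreeMonoid X →* M) (fun _ => MonCat.of M) fun _ _ hV => hV)
    (MonoidHom.pi fun φ => φ) fun p q hpq hp => ?_
  rwa [h p hp q fun φ => congrFun hpq φ]

theorem syntacticMonoid_iInter_mem {ι : Type} {T : ι → Set (FreeMonoid X)}
    (h : ∀ i, MonCat.of (SyntacticMonoid (T i)) ∈ V.carrier) :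
    MonCat.of (SyntacticMonoid (⋂ i, T i)) ∈ V.carrier := by
  refine syntacticMonoid_mem_of_recognizes (V.pi_mem ι _ h)
    (MonoidHom.pi fun i => (syntacticCon (T i)).mk') fun p q hpq hp => Set.mem_iInter.2 fun i => ?_
  exact (mem_iff_of_syntacticCon ((Con.eq _).1 (congrFun hpq i))).1 (Set.mem_iInter.1 hp i)

theorem syntacticMonoid_inter_mem_sup {U : MonoidVariety}
    (hS : MonCat.of (SyntacticMonoid S) ∈ U.carrier)
    (hT : MonCat.of (SyntacticMonoid T) ∈ V.carrier) :
    MonCat.of (SyntacticMonoid (S ∩ T)) ∈ (U ⊔ V).carrier := by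
  rw [Set.inter_eq_iInter]
  refine syntacticMonoid_iInter_mem (Bool.forall_bool.2 ⟨?_, ?_⟩)
  exacts [(le_sup_right : V ≤ U ⊔ V) hT, (le_sup_left : U ≤ U ⊔ V) hS]

theorem satisfies_syntacticMonoid {u v : FreeMonoid X}
    (h : ∀ (f : FreeMonoid X →* FreeMonoid X) (l r), l * f u * r ∈ T ↔ l * f v * r ∈ T) :
    Satisfies (SyntacticMonoid T) u v := by
  intro φ
  have hs := (syntacticCon T).mk'_surjective
  let f : FreeMonoid X →* FreeMonoid X :=
    FreeMonoid.lift fun i => Function.surjInv hs (φ (FreeMonoid.of i))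
  have hφ : φ = (syntacticCon T).mk'.comp f := by
    ext i
    simp only [MonoidHom.comp_apply, f, FreeMonoid.lift_eval_of]
    exact (Function.surjInv_eq hs _).symm
  rw [hφ]
  exact (Con.eq _).2 (h f)

theorem not_satisfies_syntacticMonoid {u v : FreeMonoid X} (hu : u ∈ T) (hv : v ∉ T) :
    ¬ Satisfies (SyntacticMonoid T) u v := fun h =>
  hv ((mem_iff_of_syntacticCon ((Con.eq _).1 (h (syntacticCon T).mk'))).1 hu)

end Identities

section Pentagon

variable {X : Type} {V : MonoidVariety}

theorem not_isModularLattice_of_square {w : Bool → Bool → FreeMonoid X}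
    (hw : Function.Injective2 w)
    (h₁ : MonCat.of (SyntacticMonoid {w false false, w true false}) ∈ V.carrier)
    (h₂ : MonCat.of (SyntacticMonoid {w false false, w false true}) ∈ V.carrier)
    (hs₁ : ∀ j, Satisfies (SyntacticMonoid {w false false, w true false}) (w false j) (w true j))
    (hs₂ : ∀ i, Satisfies (SyntacticMonoid {w false false, w false true}) (w i false) (w i true))
    (hs : Satisfies (SyntacticMonoid {w false false}) (w false true) (w true true)) :
    ¬ IsModularLattice V.SubvarietyLattice := by
  let a := V ⊓ ofIdentities {(w false false, w true false), (w false true, w true true)}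
  let b := V ⊓ ofIdentities {(w false false, w false true), (w true false, w true true)}
  let c := V ⊓ ofIdentities {(w false true, w true true)}
  let d := ofIdentities {(w false false, w true false)}
  have hac : a ≤ c := fun M hM => ⟨hM.1, fun _ h => hM.2 _ (Or.inr h)⟩
  have had : a ≤ d := fun M hM _ h => hM.2 _ (Or.inl h)
  have hbcd : b ⊓ c ≤ d := by
    rintro M ⟨hb, hc⟩ _ rfl φ
    exact (hb.2 _ (Or.inl rfl) φ).trans
      ((hc.2 _ rfl φ).trans (hb.2 _ (Or.inr rfl) φ).symm)
  have hmem : MonCat.of (SyntacticMonoid {w false false}) ∈ ((a ⊔ b) ⊓ c).carrier := by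
    have ha : MonCat.of (SyntacticMonoid {w false false, w true false}) ∈ a.carrier :=
      ⟨h₁, by rintro _ (rfl | rfl); exacts [hs₁ false, hs₁ true]⟩
    have hb : MonCat.of (SyntacticMonoid {w false false, w false true}) ∈ b.carrier :=
      ⟨h₂, by rintro _ (rfl | rfl); exacts [hs₂ false, hs₂ true]⟩
    have hinter : ({w false false, w true false} ∩ {w false false, w false true} : Set _) =
        {w false false} := by
      rw [← Set.insert_inter_distrib, Set.singleton_inter_eq_empty.2, insert_empty_eq]
      exact fun h => nomatch (hw h).1
    have hsup := syntacticMonoid_inter_mem_sup ha hb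
    rw [hinter] at hsup
    have hV : a ⊔ b ≤ V := sup_le inf_le_left inf_le_left
    exact ⟨hsup, hV hsup, by rintro _ rfl; exact hs⟩
  intro _
  have hle : (a ⊔ b) ⊓ c ≤ a ⊔ b ⊓ c :=
    IsModularLattice.sup_inf_le_assoc_of_le (α := V.SubvarietyLattice)
      (x := ⟨a, Set.mem_Iic.2 inf_le_left⟩) ⟨b, Set.mem_Iic.2 inf_le_left⟩
      (z := ⟨c, Set.mem_Iic.2 inf_le_left⟩) hac
  have hne : w true false ∉ ({w false false} : Set _) := fun h => Bool.false_ne_true (hw h).1.symm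
  exact not_satisfies_syntacticMonoid (Set.mem_singleton _) hne (sup_le had hbcd (hle hmem) _ rfl)

end Pentagon

end MonoidVariety

theorem isModularLattice_of_inf_sup_left {α : Type*} [Lattice α]
    (h : ∀ a b c : α, a ⊓ (b ⊔ c) = a ⊓ b ⊔ a ⊓ c) : IsModularLattice α :=
  let _ : DistribLattice α := DistribLattice.ofInfSupLe fun a b c => (h a b c).le
  inferInstance

namespace FactorMonoid

variable {α : Type} {w : List α}

/-- The homomorphism from the free monoid to `M(w)` that extends a substitution of words for
letters. -/
noncomputable def eval {X : Type} (w : List α) (f : X → List α) :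
    FreeMonoid X →* FactorMonoid w where
  toFun u := ofWord w (u.toList.flatMap f)
  map_one' := rfl
  map_mul' u v := by
    rw [FreeMonoid.toList_mul, List.flatMap_append]
    exact (ofWord_mul _ _).symm

theorem eq_of_ofWord_eq {u v : List α} (h : ofWord w u = ofWord w v) (hu : u <:+: w) : u = v := by
  by_cases hv : v <:+: w
  · rw [ofWord_val ⟨u, hu⟩, ofWord_val ⟨v, hv⟩] at h
    exact congrArg Subtype.val (Option.some.inj h)
  · rw [ofWord_val ⟨u, hu⟩, ofWord_of_not hv] at h
    cases h

end FactorMonoid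

open List

section Precedes

variable {α β : Type*} {a b c : α} {l l' : List α}

/-- Some occurrence of `a` in the word `l` precedes some occurrence of `b`. -/
abbrev Precedes (l : List α) (a b : α) : Prop := [a, b] <+ l

theorem precedes_cons_iff : Precedes (c :: l) a b ↔ a = c ∧ b ∈ l ∨ Precedes l a b := by
  grind

theorem precedes_append_iff :
    Precedes (l ++ l') a b ↔ Precedes l a b ∨ a ∈ l ∧ b ∈ l' ∨ Precedes l' a b := by
  induction l with
  | nil => simp
  | cons c l ih =>
    rw [cons_append, precedes_cons_iff, ih, precedes_cons_iff]
    grind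

theorem precedes_or_precedes (ha : a ∈ l) (hb : b ∈ l) (hab : a ≠ b) :
    Precedes l a b ∨ Precedes l b a := by
  induction l with
  | nil => simp at ha
  | cons c l ih =>
    rw [precedes_cons_iff, precedes_cons_iff]
    grind

namespace Precedes

theorem left_mem (h : Precedes l a b) : a ∈ l := h.subset mem_cons_self

theorem right_mem (h : Precedes l a b) : b ∈ l := h.subset (mem_cons_of_mem _ mem_cons_self)

theorem triple (h : Precedes l a b) (h' : Precedes l b c) (hl : l.Nodup) : [a, b, c] <+ l := by
  induction l with
  | nil => simp at h
  | cons d l ih =>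
    rw [precedes_cons_iff] at h h'
    have hn := nodup_cons.1 hl
    rcases h' with ⟨rfl, -⟩ | h'
    · rcases h with ⟨-, h⟩ | h
      exacts [absurd h hn.1, absurd h.right_mem hn.1]
    · rcases h with ⟨rfl, -⟩ | h
      exacts [h'.cons_cons _, (ih h h' hn.2).cons _]

theorem trans (h : Precedes l a b) (h' : Precedes l b c) (hl : l.Nodup) : Precedes l a c :=
  Sublist.trans (by simp) (h.triple h' hl)

theorem ne (h : Precedes l a b) (hl : l.Nodup) : a ≠ b := by
  rintro rfl
  exact nodup_iff_sublist.1 hl a h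

theorem asymm (h : Precedes l a b) (hl : l.Nodup) : ¬ Precedes l b a := fun h' =>
  (h.trans h' hl).ne hl rfl

end Precedes

theorem eq_of_forall_infix_precedes (hl' : l'.Nodup) (hp : l' ~ l)
    (h : ∀ a b, [a, b] <:+: l → Precedes l' a b) : l' = l := by
  let _ : Trans (Precedes l') (Precedes l') (Precedes l') := ⟨fun h h' => h.trans h' hl'⟩
  have hchain : l.IsChain (Precedes l') := isChain_iff_forall_rel_of_append_cons_cons.2
    fun {a b s t} hst => h a b ⟨s, t, by simp [hst]⟩
  exact hp.eq_of_pairwise (fun a b _ _ hab hba => absurd hba (Precedes.asymm hab hl'))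
    (pairwise_iff_forall_sublist.2 id) hchain.pairwise

theorem flatMap_eq_of_sublist (h : l' <+ l) (hl : l.Nodup) {f : α → List β}
    (hf : ∀ a ∈ l, a ∉ l' → f a = []) : l.flatMap f = l'.flatMap f := by
  induction h with
  | slnil => rfl
  | cons a hs ih => grind [hs.subset]
  | cons_cons a _ ih => grind

variable [DecidableEq α]

theorem flatMap_update_of_notMem {f : α → List β} {v : List β} (ha : a ∉ l) :
    l.flatMap (Function.update f a v) = l.flatMap f :=
  flatMap_congr fun _ hi => Function.update_of_ne (ne_of_mem_of_not_mem hi ha) _ _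

theorem flatMap_update_singleton (l : List α) (a : α) (x : β) :
    l.flatMap (Function.update (fun _ => []) a [x]) = replicate (count a l) x := by
  induction l with
  | nil => rfl
  | cons c l ih =>
    rw [flatMap_cons, ih, count_cons]
    by_cases hc : c = a <;> simp [hc, replicate_succ]

end Precedes

section Isoterms

variable {α β : Type*} {c : List β}

/-- Every substitution that sends one of the words `w` and `w'` to a factor of `c` sends both words
to the same word. -/
def SameImages (c : List β) (w w' : List α) : Prop :=
  ∀ f : α → List β, w.flatMap f <:+: c ∨ w'.flatMap f <:+: c → w.flatMap f = w'.flatMap f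

theorem MonoidVariety.Satisfies.sameImages {X α : Type} {c : List α} {p q : FreeMonoid X}
    (h : MonoidVariety.Satisfies (FactorMonoid c) p q) : SameImages c p.toList q.toList := by
  intro f hf
  have hf' : FactorMonoid.ofWord c (p.toList.flatMap f) =
      FactorMonoid.ofWord c (q.toList.flatMap f) := h (FactorMonoid.eval c f)
  rcases hf with hf | hf
  exacts [FactorMonoid.eq_of_ofWord_eq hf' hf, (FactorMonoid.eq_of_ofWord_eq hf'.symm hf).symm]

/-- The word `c` has a factor of the form `xyvx` and a factor of one of the forms `esgteg` and
`esgtge`, where `x, y` and `e, g` are pairs of distinct letters and `v, s, t` are words. These are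
the factors against which the words that are to be isoterms for `M(c)` are tested. -/
structure HasCrossings (c : List β) : Prop where
  exists_return : ∃ (x y : β) (v : List β), x ≠ y ∧ x :: y :: (v ++ [x]) <:+: c
  exists_crossing : ∃ (e g : β) (s t : List β), e ≠ g ∧
    (e :: (s ++ g :: (t ++ [e, g])) <:+: c ∨ e :: (s ++ g :: (t ++ [g, e])) <:+: c)

/-- The word `F τ S` consists of two words `F` and `S` without repeated letters, separated by a
letter `τ` that occurs in neither of them, and every letter of `S` occurs in `F`. Its multiple
letters are therefore those of `S`, and they occur once in either half. -/
structure LinearHalves (F : List α) (τ : α) (S : List α) : Prop where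
  nodup_left : F.Nodup
  nodup_right : S.Nodup
  notMem_left : τ ∉ F
  subset : S ⊆ F

namespace LinearHalves

variable {F F' S S' : List α} {τ : α}

theorem notMem_right (h : LinearHalves F τ S) : τ ∉ S := fun hτ => h.notMem_left (h.subset hτ)

theorem perm (h : LinearHalves F τ S) (hF : F' ~ F) (hS : S' ~ S) : LinearHalves F' τ S' where
  nodup_left := hF.nodup_iff.2 h.nodup_left
  nodup_right := hS.nodup_iff.2 h.nodup_right
  notMem_left := mt hF.mem_iff.1 h.notMem_left
  subset := fun _ ha => hF.mem_iff.2 (h.subset (hS.mem_iff.1 ha))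

theorem flatMap_of_separated (h : LinearHalves F τ S) {e s g a b : α} (hs : s ∉ S)
    (hesg : [e, s, g] <+ F) (hab : Precedes S a b) (hperm : [a, b] ~ [e, g]) {f : α → List β}
    (hf : ∀ i, i ≠ τ → i ∉ [e, s, g] → f i = []) :
    (F ++ τ :: S).flatMap f = f e ++ (f s ++ (f g ++ (f τ ++ (f a ++ f b)))) := by
  have hfF : ∀ i ∈ F, i ∉ [e, s, g] → f i = [] := fun i hi =>
    hf i (ne_of_mem_of_not_mem hi h.notMem_left)
  have hfS : ∀ i ∈ S, i ∉ [a, b] → f i = [] := by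
    intro i hi hiab
    have hieg : i ∉ [e, g] := mt hperm.mem_iff.2 hiab
    have his : i ≠ s := ne_of_mem_of_not_mem hi hs
    exact hf i (ne_of_mem_of_not_mem hi h.notMem_right) (by simp_all)
  rw [flatMap_append, flatMap_cons, flatMap_eq_of_sublist hesg h.nodup_left hfF,
    flatMap_eq_of_sublist hab h.nodup_right hfS]
  simp

end LinearHalves

theorem replicate_append_cons_inj {i j i' j' : ℕ} {x y : β} {v : List β} (hxy : x ≠ y) :
    replicate i x ++ y :: (v ++ replicate j x) = replicate i' x ++ y :: (v ++ replicate j' x) ↔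
      i = i' ∧ j = j' := by
  constructor
  · intro h
    induction i generalizing i' with
    | zero => cases i' <;> simp_all [hxy.symm, replicate_succ, replicate_inj]
    | succ i ih => cases i' <;> simp_all [replicate_succ]
  · rintro ⟨rfl, rfl⟩
    rfl

theorem replicate_append_cons_infix {i j : ℕ} (hi : i ≤ 1) (hj : j ≤ 1) (x y : β) (v : List β) :
    replicate i x ++ y :: (v ++ replicate j x) <:+: x :: y :: (v ++ [x]) :=
  ⟨replicate (1 - i) x, replicate (1 - j) x, by interval_cases i <;> interval_cases j <;> simp⟩

namespace SameImages

variable {w w' F F' S S' : List α} {τ : α}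

theorem symm (h : SameImages c w w') : SameImages c w' w := fun f hf => (h f hf.symm).symm

open Classical in
theorem count_eq_one (h : SameImages c w w') (hc : c ≠ []) {a : α} (ha : count a w = 1) :
    count a w' = 1 := by
  obtain ⟨x, l, rfl⟩ := exists_cons_of_ne_nil hc
  have himage := h (Function.update (fun _ => []) a [x])
  simp only [flatMap_update_singleton, ha] at himage
  exact ((replicate_inj.1 (himage (Or.inl ⟨[], l, by simp⟩))).1).symm

open Classical in
theorem count_eq_count (hc : HasCrossings c) (hw : LinearHalves F τ S) (hF' : τ ∉ F')
    (hS' : τ ∉ S') (h : SameImages c (F ++ τ :: S) (F' ++ τ :: S')) (k : α) :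
    count k F' = count k F ∧ count k S' = count k S := by
  obtain ⟨x, y, v, hxy, hfac⟩ := hc.exists_return
  let f := Function.update (Function.update (fun _ => []) k [x]) τ (y :: v)
  have himage : ∀ L M : List α, τ ∉ L → τ ∉ M → (L ++ τ :: M).flatMap f =
      replicate (count k L) x ++ y :: (v ++ replicate (count k M) x) := by
    intro L M hL hM
    rw [flatMap_append, flatMap_cons, flatMap_update_of_notMem hL, flatMap_update_of_notMem hM,
      flatMap_update_singleton, flatMap_update_singleton, show f τ = y :: v from
        Function.update_self _ _ _, cons_append]
  have heq := h f (Or.inl ?_)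
  · rw [himage _ _ hw.notMem_left hw.notMem_right, himage _ _ hF' hS',
      replicate_append_cons_inj hxy] at heq
    exact ⟨heq.1.symm, heq.2.symm⟩
  · rw [himage _ _ hw.notMem_left hw.notMem_right]
    exact (replicate_append_cons_infix (nodup_iff_count_le_one.1 hw.nodup_left k)
      (nodup_iff_count_le_one.1 hw.nodup_right k) x y v).trans hfac

theorem exists_perm (hc : HasCrossings c) (hw : LinearHalves F τ S)
    (h : SameImages c (F ++ τ :: S) w') : ∃ F' S', w' = F' ++ τ :: S' ∧ F' ~ F ∧ S' ~ S := by
  classical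
  have hc' : c ≠ [] := by
    rintro rfl
    obtain ⟨x, y, v, -, hfac⟩ := hc.exists_return
    simp at hfac
  have hcount : count τ w' = 1 := h.count_eq_one hc' (by
    rw [count_append, count_cons_self, count_eq_zero_of_not_mem hw.notMem_left,
      count_eq_zero_of_not_mem hw.notMem_right])
  obtain ⟨F', S', rfl⟩ := append_of_mem (count_pos_iff.1 (hcount ▸ one_pos))
  rw [count_append, count_cons_self] at hcount
  have key := h.count_eq_count hc hw (count_eq_zero.1 (by lia)) (count_eq_zero.1 (by lia))
  exact ⟨F', S', rfl, perm_iff_count.2 fun k => (key k).1, perm_iff_count.2 fun k => (key k).2⟩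

theorem precedes_of_right_simple (hc : HasCrossings c) (hw : LinearHalves F τ S) (hF' : F' ~ F)
    (h : SameImages c (F ++ τ :: S) (F' ++ τ :: S')) {k s : α} (hs : s ∉ S)
    (hks : Precedes F k s) : Precedes F' k s := by
  classical
  obtain ⟨x, y, v, hxy, hfac⟩ := hc.exists_return
  have hne : k ≠ s := hks.ne hw.nodup_left
  by_contra hcon
  have hsk : Precedes F' s k := (precedes_or_precedes (hF'.mem_iff.2 hks.left_mem)
    (hF'.mem_iff.2 hks.right_mem) hne).resolve_left hcon
  let f := Function.update (Function.update (fun _ => []) k [x]) s (y :: v)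
  have hfk : f k = [x] := by simp [f, hne]
  have hfs : f s = y :: v := Function.update_self _ _ _
  have hf : ∀ i, i ≠ k → i ≠ s → f i = [] := fun i hk hs => by simp [f, hk, hs]
  have hfτ : f τ = [] := hf τ (fun e => hw.notMem_left (e ▸ hks.left_mem))
    (fun e => hw.notMem_left (e ▸ hks.right_mem))
  have hFf : F.flatMap f = x :: y :: v := by
    rw [flatMap_eq_of_sublist hks hw.nodup_left fun i _ hi => hf i (by grind) (by grind)]
    simp [hfk, hfs]
  have hFf' : F'.flatMap f = y :: (v ++ [x]) := by
    rw [flatMap_eq_of_sublist hsk (hF'.nodup_iff.2 hw.nodup_left) fun i _ hi =>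
      hf i (by grind) (by grind)]
    simp [hfk, hfs]
  have hSf : S.flatMap f = replicate (count k S) x := by
    rw [flatMap_update_of_notMem hs, flatMap_update_singleton]
  have heq := h f (Or.inl ?_)
  · simp only [flatMap_append, flatMap_cons, hFf, hFf', cons_append, cons.injEq] at heq
    exact hxy heq.1
  · rw [flatMap_append, flatMap_cons, hFf, hfτ, hSf]
    exact (replicate_append_cons_infix le_rfl (nodup_iff_count_le_one.1 hw.nodup_right k)
      x y v).trans hfac

theorem precedes_of_left_simple (hc : HasCrossings c) (hw : LinearHalves F τ S) (hF' : F' ~ F)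
    (hS' : S' ~ S) (h : SameImages c (F ++ τ :: S) (F' ++ τ :: S')) {k s : α} (hs : s ∉ S)
    (hsk : Precedes F s k) : Precedes F' s k := by
  refine (precedes_or_precedes (hF'.mem_iff.2 hsk.left_mem) (hF'.mem_iff.2 hsk.right_mem)
    (hsk.ne hw.nodup_left)).resolve_right fun hks => ?_
  exact hsk.asymm hw.nodup_left (h.symm.precedes_of_right_simple hc (hw.perm hF' hS') hF'.symm
    (mt hS'.mem_iff.1 hs) hks)

theorem triple_sublist_of_simple (hc : HasCrossings c) (hw : LinearHalves F τ S) (hF' : F' ~ F)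
    (hS' : S' ~ S) (h : SameImages c (F ++ τ :: S) (F' ++ τ :: S')) {e s g : α} (hs : s ∉ S)
    (hesg : [e, s, g] <+ F) : [e, s, g] <+ F' :=
  (h.precedes_of_right_simple hc hw hF' hs (Sublist.trans (by simp) hesg)).triple
    (h.precedes_of_left_simple hc hw hF' hS' hs (Sublist.trans (by simp) hesg))
    (hF'.nodup_iff.2 hw.nodup_left)

theorem not_reversed_of_separated (hc : HasCrossings c) (hw : LinearHalves F τ S)
    (hw' : LinearHalves F' τ S') (h : SameImages c (F ++ τ :: S) (F' ++ τ :: S')) {e s g : α}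
    (hs : s ∉ S) (hs' : s ∉ S') (hesg : [e, s, g] <+ F) (hesg' : [e, s, g] <+ F')
    (heg : Precedes S e g) : ¬ Precedes S' g e := by
  classical
  intro hge
  obtain ⟨x, y, u, v, hxy, hfac⟩ := hc.exists_crossing
  obtain ⟨⟨hes, heg'⟩, hsg⟩ : (e ≠ s ∧ e ≠ g) ∧ s ≠ g := by
    simpa using hesg.nodup hw.nodup_left
  obtain ⟨hτe, hτs, hτg⟩ : τ ≠ e ∧ τ ≠ s ∧ τ ≠ g := by
    simpa using fun hτ => hw.notMem_left (hesg.subset hτ)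
  let f := Function.update (Function.update (Function.update (Function.update (fun _ => [])
    τ v) s u) g [y]) e [x]
  have hfe : f e = [x] := Function.update_self _ _ _
  have hfg : f g = [y] := by simp [f, heg'.symm]
  have hfs : f s = u := by simp [f, hes.symm, hsg]
  have hfτ : f τ = v := by simp [f, hτe, hτs, hτg]
  have hf : ∀ i, i ≠ τ → i ∉ [e, s, g] → f i = [] := by
    intro i hiτ hi
    obtain ⟨hie, his, hig⟩ : i ≠ e ∧ i ≠ s ∧ i ≠ g := by simpa using hi
    simp [f, hiτ, hie, his, hig]
  have hF := hw.flatMap_of_separated hs hesg heg (.refl _) hf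
  have hF' := hw'.flatMap_of_separated hs' hesg' hge (.swap _ _ _) hf
  rw [hfe, hfs, hfg, hfτ] at hF hF'
  have heq := h f (by rw [hF, hF']; exact hfac)
  rw [hF, hF'] at heq
  simp [hxy] at heq

/-- A simple letter between the first occurrences of two multiple letters fixes the order of their
second occurrences. -/
theorem precedes_of_separated (hc : HasCrossings c) (hw : LinearHalves F τ S) (hF' : F' ~ F)
    (hS' : S' ~ S) (h : SameImages c (F ++ τ :: S) (F' ++ τ :: S')) {e s g a b : α} (hs : s ∉ S)
    (hesg : [e, s, g] <+ F) (hab : a = e ∧ b = g ∨ a = g ∧ b = e) (hS : Precedes S a b) :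
    Precedes S' a b := by
  have hw' := hw.perm hF' hS'
  have hs' := mt hS'.mem_iff.1 hs
  have hesg' := h.triple_sublist_of_simple hc hw hF' hS' hs hesg
  refine (precedes_or_precedes (hS'.mem_iff.2 hS.left_mem) (hS'.mem_iff.2 hS.right_mem)
    (hS.ne hw.nodup_right)).resolve_right fun hba => ?_
  rcases hab with ⟨rfl, rfl⟩ | ⟨rfl, rfl⟩
  · exact h.not_reversed_of_separated hc hw hw' hs hs' hesg hesg' hS hba
  · exact h.symm.not_reversed_of_separated hc hw' hw hs' hs hesg' hesg hba hS

end SameImages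

end Isoterms

namespace SameImages

variable {α β : Type*} {c : List β} {F F' S S' : List α} {τ : α} {T : α → α → Prop}

theorem right_eq_of_separated (hc : HasCrossings c) (hw : LinearHalves F τ S) (hF' : F' ~ F)
    (hS' : S' ~ S) (h : SameImages c (F ++ τ :: S) (F' ++ τ :: S'))
    (hsep : ∀ u v, u ∈ S → v ∈ S → Precedes F u v → ¬ T u v → ∃ s, s ∉ S ∧ [u, s, v] <+ F)
    (hS : ∀ u v, [u, v] <:+: S → ¬ T u v ∧ ¬ T v u) : S' = S := by
  refine eq_of_forall_infix_precedes (hS'.nodup_iff.2 hw.nodup_right) hS' fun u v huv => ?_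
  have hS_uv : Precedes S u v := huv.sublist
  have hu := hS_uv.left_mem
  have hv := hS_uv.right_mem
  rcases precedes_or_precedes (hw.subset hu) (hw.subset hv) (hS_uv.ne hw.nodup_right) with hF | hF
  · obtain ⟨s, hs, husv⟩ := hsep u v hu hv hF (hS u v huv).1
    exact h.precedes_of_separated hc hw hF' hS' hs husv (.inl ⟨rfl, rfl⟩) hS_uv
  · obtain ⟨s, hs, hvsu⟩ := hsep v u hv hu hF (hS u v huv).2
    exact h.precedes_of_separated hc hw hF' hS' hs hvsu (.inr ⟨rfl, rfl⟩) hS_uv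

theorem precedes_left_of_separated (hc : HasCrossings c) (hw : LinearHalves F τ S) (hF' : F' ~ F)
    (hS' : S' ~ S) (h : SameImages c (F ++ τ :: S) (F' ++ τ :: S'))
    (hsep : ∀ u v, u ∈ S → v ∈ S → Precedes F u v → ¬ T u v → ∃ s, s ∉ S ∧ [u, s, v] <+ F)
    {u v : α} (huv : Precedes F u v) (hT : ¬ T u v) : Precedes F' u v := by
  by_cases hu : u ∈ S
  · by_cases hv : v ∈ S
    · obtain ⟨s, hs, husv⟩ := hsep u v hu hv huv hT
      exact Sublist.trans (by simp) (h.triple_sublist_of_simple hc hw hF' hS' hs husv)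
    · exact h.precedes_of_right_simple hc hw hF' hv huv
  · exact h.precedes_of_left_simple hc hw hF' hS' hu huv

end SameImages

/-- The word `uv` if `i` is false, and `vu` if `i` is true. -/
def swapIf {α : Type*} (i : Bool) (u v : α) : List α := bif i then [v, u] else [u, v]

theorem mem_swapIf {α : Type*} {i : Bool} {u v w : α} : w ∈ swapIf i u v ↔ w = u ∨ w = v := by
  cases i <;> simp [swapIf, or_comm]

theorem exists_swapIf_sublist {α : Type*} {u v : α} {l : List α} (hu : u ∈ l) (hv : v ∈ l)
    (huv : u ≠ v) : ∃ i, swapIf i u v <+ l :=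
  (precedes_or_precedes hu hv huv).elim (⟨false, ·⟩) (⟨true, ·⟩)

/-- The word `(∏ zₖ tₖ) x y t (∏ zₖ tₖ) x (∏ zₖ) y` with `k` running through `is`, `js` and `ks`
in this order, where the factor `xy` is replaced by `yx` if `i` is true. -/
def baseWord (i : Bool) (is js ks : List ℕ) : List Letter :=
  is.flatMap (fun k => [Letter.z k, Letter.ti k]) ++ (swapIf i Letter.x Letter.y ++ Letter.t ::
    (js.flatMap (fun k => [Letter.z k, Letter.ti k]) ++
      Letter.x :: (ks.map Letter.z ++ [Letter.y])))

theorem cWord_zero (n m : ℕ) (ρ : Equiv.Perm (Fin (n + m))) :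
    cWord n m 0 ρ = baseWord false (range n) (range' n m)
      ((finRange (n + m)).map fun i => (ρ i).val) := by
  simp [cWord, baseWord, swapIf, Function.comp_def]

theorem nodup_range_append_range' (n m : ℕ) : (range n ++ range' n m).Nodup := by
  have h := range'_append_1 (s := 0) (m := n) (n := m)
  rw [Nat.zero_add] at h
  rw [range_eq_range', h]
  exact nodup_range'

theorem map_val_finRange_perm {n m : ℕ} (ρ : Equiv.Perm (Fin (n + m))) :
    ((finRange (n + m)).map fun i => (ρ i).val) ~ range n ++ range' n m := by
  refine (perm_ext_iff_of_nodup ?_ (nodup_range_append_range' n m)).2 fun k => ?_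
  · exact (nodup_finRange _).map fun _ _ h => ρ.injective (Fin.ext h)
  · simp only [mem_map, mem_finRange, true_and, mem_append, mem_range, mem_range'_1]
    constructor
    · rintro ⟨i, rfl⟩
      have := (ρ i).isLt
      lia
    · intro h
      exact ⟨ρ.symm ⟨k, by lia⟩, by simp⟩

section baseWord

variable {i i' : Bool} {is js ks : List ℕ}

theorem baseWord_inj (h : baseWord i is js ks = baseWord i' is js ks) : i = i' := by
  have hswap : swapIf i Letter.x Letter.y = swapIf i' Letter.x Letter.y :=
    append_inj_left (append_cancel_left h) (by cases i <;> cases i' <;> rfl)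
  cases i <;> cases i' <;> simp_all [swapIf]

theorem SameImages.eq_of_flatMap_baseWord {α : Type*} {w w' : List α}
    (h : SameImages (baseWord false is js ks) w w') {f : α → List Letter}
    (hw : w.flatMap f = baseWord i is js ks) (hw' : w'.flatMap f = baseWord i' is js ks) :
    i = i' := by
  by_contra hne
  have hfalse : i = false ∨ i' = false := by grind
  have heq := h f (by rcases hfalse with rfl | rfl <;> simp [hw, hw'])
  exact hne (baseWord_inj (by rw [← hw, heq, hw']))

theorem hasCrossings_baseWord (hk : ks ~ is ++ js) : HasCrossings (baseWord false is js ks) where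
  exists_return :=
    ⟨Letter.x, Letter.y, Letter.t :: js.flatMap fun k => [Letter.z k, Letter.ti k], by simp,
      is.flatMap fun k => [Letter.z k, Letter.ti k], ks.map Letter.z ++ [Letter.y],
      by simp [baseWord, swapIf]⟩
  exists_crossing := by
    rcases ks with _ | ⟨k, ks⟩
    · obtain ⟨rfl, rfl⟩ := append_eq_nil_iff.1 hk.nil_eq.symm
      exact ⟨Letter.x, Letter.y, [], [Letter.t], by simp, .inl ⟨[], [], rfl⟩⟩
    · have hk' : k ∈ is ++ js := hk.subset mem_cons_self
      rcases mem_append.1 hk' with hk' | hk' <;> obtain ⟨l₁, l₂, rfl⟩ := append_of_mem hk'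
      · exact ⟨Letter.z k, Letter.x, Letter.ti k :: l₂.flatMap fun k => [Letter.z k, Letter.ti k],
          Letter.y :: Letter.t :: js.flatMap fun k => [Letter.z k, Letter.ti k], by simp,
          .inr ⟨l₁.flatMap fun k => [Letter.z k, Letter.ti k], ks.map Letter.z ++ [Letter.y],
            by simp [baseWord, swapIf]⟩⟩
      · exact ⟨Letter.x, Letter.z k,
          Letter.y :: Letter.t :: l₁.flatMap fun k => [Letter.z k, Letter.ti k],
          Letter.ti k :: l₂.flatMap fun k => [Letter.z k, Letter.ti k], by simp,
          .inl ⟨is.flatMap fun k => [Letter.z k, Letter.ti k], ks.map Letter.z ++ [Letter.y],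
            by simp [baseWord, swapIf]⟩⟩

end baseWord

/-- The letters of the words `dWord`: the letters `x₁, y₁, x₂, y₂, p, a k` occur twice, and the
others once. -/
inductive DLetter : Type
  | x₁ : DLetter
  | y₁ : DLetter
  | x₂ : DLetter
  | y₂ : DLetter
  | p : DLetter
  | t₁ : DLetter
  | t₂ : DLetter
  | t₃ : DLetter
  | t₄ : DLetter
  | a : ℕ → DLetter
  | b : ℕ → DLetter

namespace DLetter

/-- The word `∏ aₖ bₖ`, with `k` running through `l`. -/
def pairWord (l : List ℕ) : List DLetter := l.flatMap fun k => [a k, b k]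

/-- The part of `dWord` with the first occurrences of the letters. -/
def fWord (i j : Bool) (is js : List ℕ) : List DLetter :=
  pairWord is ++ (swapIf i x₁ y₁ ++ t₁ :: p :: t₂ :: (swapIf j x₂ y₂ ++ t₃ :: pairWord js))

/-- The part of `dWord` with the second occurrences of the letters. -/
def sWord (ks : List ℕ) : List DLetter := x₁ :: x₂ :: (ks.map a ++ [p, y₂, y₁])

/-- The word `(∏ aₖ bₖ) x₁ y₁ t₁ p t₂ x₂ y₂ t₃ (∏ aₖ bₖ) t₄ x₁ x₂ (∏ aₖ) p y₂ y₁`, where the first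
occurrences of `x₁` and `y₁` are swapped if `i` is true, and those of `x₂` and `y₂` if `j` is. -/
def dWord (i j : Bool) (is js ks : List ℕ) : List DLetter := fWord i j is js ++ t₄ :: sWord ks

/-- Two distinct letters are twins if both of them occur twice and their first occurrences in some
`dWord` are adjacent. -/
def Twin (u v : DLetter) : Prop :=
  (u = x₁ ∧ v = y₁) ∨ (u = y₁ ∧ v = x₁) ∨ (u = x₂ ∧ v = y₂) ∨ (u = y₂ ∧ v = x₂)

theorem Twin.symm {u v : DLetter} (h : Twin u v) : Twin v u := by
  unfold Twin at h ⊢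
  tauto

theorem mem_pairWord {l : List ℕ} {u : DLetter} :
    u ∈ pairWord l ↔ ∃ k ∈ l, u = a k ∨ u = b k := by
  simp [pairWord]

theorem nodup_pairWord {l : List ℕ} (hl : l.Nodup) : (pairWord l).Nodup := by
  refine nodup_flatMap.2 ⟨by simp, hl.imp fun hne => ?_⟩
  simp [Function.onFun, hne.symm]

section

variable {i j i' j' : Bool} {is js ks : List ℕ} {u v : DLetter}

theorem mem_sWord :
    u ∈ sWord ks ↔ u = x₁ ∨ u = x₂ ∨ (∃ k ∈ ks, u = a k) ∨ u = p ∨ u = y₂ ∨ u = y₁ := by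
  simp [sWord, eq_comm]

theorem mem_fWord :
    u ∈ fWord i j is js ↔ u ∈ pairWord is ∨ u = x₁ ∨ u = y₁ ∨ u = t₁ ∨ u = p ∨ u = t₂ ∨
      u = x₂ ∨ u = y₂ ∨ u = t₃ ∨ u ∈ pairWord js := by
  simp only [fWord, mem_append, mem_cons, mem_swapIf]
  tauto

theorem fWord_perm :
    fWord i j is js ~ [x₁, y₁, x₂, y₂, t₁, t₂, t₃, p] ++ pairWord (is ++ js) := by
  classical
  rw [perm_iff_count]
  intro u
  cases i <;> cases j <;> simp [fWord, swapIf, pairWord, count_cons] <;> lia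

theorem nodup_fWord (h : (is ++ js).Nodup) : (fWord i j is js).Nodup :=
  fWord_perm.nodup_iff.2
    (nodup_append.2 ⟨by simp, nodup_pairWord h, by simp [mem_pairWord]; grind⟩)

theorem nodup_sWord (h : ks.Nodup) : (sWord ks).Nodup := by
  have : (ks.map a).Nodup := h.map fun _ _ h => by injection h
  simp only [sWord, nodup_cons, nodup_append]
  simp [this]

theorem sWord_subset_fWord (hk : ks ~ is ++ js) : sWord ks ⊆ fWord i j is js := by
  intro u hu
  simp only [mem_sWord, mem_fWord, mem_pairWord, hk.mem_iff, mem_append] at hu ⊢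
  grind

theorem linearHalves_dWord (hd : (is ++ js).Nodup) (hk : ks ~ is ++ js) :
    LinearHalves (fWord i j is js) t₄ (sWord ks) where
  nodup_left := nodup_fWord hd
  nodup_right := nodup_sWord (hk.nodup_iff.2 hd)
  notMem_left := by simp [mem_fWord, mem_pairWord]
  subset := sWord_subset_fWord hk

theorem Twin.of_precedes_swapIf {w z : DLetter} (hwz : Twin w z) (h : Precedes (swapIf i w z) u v) :
    Twin u v := by
  cases i
  · obtain ⟨rfl, rfl⟩ : u = w ∧ v = z := by simpa [swapIf, precedes_cons_iff] using h
    exact hwz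
  · obtain ⟨rfl, rfl⟩ : u = z ∧ v = w := by simpa [swapIf, precedes_cons_iff] using h
    exact hwz.symm

theorem exists_swapIf_eq_of_twin {w z : DLetter} (hwz : Twin w z) (hu : u = w ∨ u = z) (i : Bool) :
    ∃ A r, swapIf i w z = A ++ u :: r ∧ ∀ v ∈ r, Twin u v := by
  obtain ⟨A, r, hAr⟩ := append_of_mem (mem_swapIf (i := i).2 hu)
  refine ⟨A, r, hAr, fun v hv => hwz.of_precedes_swapIf (i := i) ?_⟩
  rw [hAr, precedes_append_iff, precedes_cons_iff]
  exact .inr (.inr (.inl ⟨rfl, hv⟩))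

theorem exists_pairWord_eq {l : List ℕ} {k : ℕ} (hk : k ∈ l) :
    ∃ A B, pairWord l = A ++ a k :: b k :: B := by
  obtain ⟨l₁, l₂, rfl⟩ := append_of_mem hk
  exact ⟨pairWord l₁, pairWord l₂, by simp [pairWord]⟩

theorem exists_next_simple (hk : ks ~ is ++ js) (hu : u ∈ sWord ks) (i j : Bool) :
    ∃ A r s B, fWord i j is js = A ++ u :: (r ++ s :: B) ∧ s ∉ sWord ks ∧ ∀ v ∈ r, Twin u v := by
  have hu' : (u = x₁ ∨ u = y₁) ∨ u = p ∨ (u = x₂ ∨ u = y₂) ∨ ∃ k ∈ is ++ js, u = a k := by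
    simp only [mem_sWord, hk.mem_iff] at hu
    tauto
  rcases hu' with hu | rfl | hu | ⟨k, hk, rfl⟩
  · obtain ⟨A, r, hAr, hr⟩ := exists_swapIf_eq_of_twin (by simp [Twin]) hu i
    exact ⟨pairWord is ++ A, r, t₁, _, by simp [fWord, hAr]; rfl, by simp [mem_sWord], hr⟩
  · exact ⟨pairWord is ++ (swapIf i x₁ y₁ ++ [t₁]), [], t₂, _, by simp [fWord]; rfl,
      by simp [mem_sWord], by simp⟩
  · obtain ⟨A, r, hAr, hr⟩ := exists_swapIf_eq_of_twin (by simp [Twin]) hu j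
    exact ⟨pairWord is ++ (swapIf i x₁ y₁ ++ t₁ :: p :: t₂ :: A), r, t₃, _,
      by simp [fWord, hAr]; rfl, by simp [mem_sWord], hr⟩
  · rcases mem_append.1 hk with hk | hk <;> obtain ⟨A, B, hAB⟩ := exists_pairWord_eq hk
    · exact ⟨A, [], b k, _, by rw [fWord, hAB]; simp; rfl, by simp [mem_sWord], by simp⟩
    · exact ⟨pairWord is ++ (swapIf i x₁ y₁ ++ t₁ :: p :: t₂ :: (swapIf j x₂ y₂ ++ t₃ :: A)), [],
        b k, B, by simp [fWord, hAB], by simp [mem_sWord], by simp⟩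

theorem exists_separator (hd : (is ++ js).Nodup) (hk : ks ~ is ++ js) (hu : u ∈ sWord ks)
    (hv : v ∈ sWord ks) (huv : Precedes (fWord i j is js) u v) (ht : ¬ Twin u v) :
    ∃ s, s ∉ sWord ks ∧ [u, s, v] <+ fWord i j is js := by
  obtain ⟨A, r, s, B, hF, hs, hr⟩ := exists_next_simple hk hu i j
  have hn := nodup_fWord (i := i) (j := j) hd
  rw [hF] at hn huv ⊢
  refine ⟨s, hs, ?_⟩
  have hvB : v ∈ B := by
    rw [precedes_append_iff, precedes_cons_iff] at huv
    have hvs := ne_of_mem_of_not_mem hv hs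
    have hvr := mt (hr v) ht
    have hu' := (nodup_middle.1 hn)
    grind [Precedes.left_mem]
  refine Sublist.trans ?_ (sublist_append_right A _)
  refine Sublist.cons_cons u (Sublist.trans ?_ (sublist_append_right r _))
  exact Sublist.cons_cons s (singleton_sublist.2 hvB)

theorem not_twin_of_infix_sWord (h : [u, v] <:+: sWord ks) : ¬ Twin u v := by
  have hchain : (sWord ks).IsChain fun u v => ¬ Twin u v := by
    have hxap : (x₁ :: x₂ :: ks.map a ++ [p]).Pairwise fun u v => ¬ Twin u v := by
      simp only [Twin, cons_append, pairwise_cons, pairwise_append, pairwise_map]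
      simp [or_imp, forall_and, pairwise_of_forall]
    exact isChain_split.2 ⟨hxap.isChain, by simp [Twin]⟩
  obtain ⟨s, t, hst⟩ := h
  exact isChain_iff_forall_rel_of_append_cons_cons.1 hchain (by simpa using hst.symm)

theorem precedes_fWord_of_not_twin (ht : ¬ Twin u v) (h : Precedes (fWord i j is js) u v) :
    Precedes (fWord i' j' is js) u v := by
  have h₁ := fun i => mt (Twin.of_precedes_swapIf (i := i) (by simp [Twin] : Twin x₁ y₁)) ht
  have h₂ := fun i => mt (Twin.of_precedes_swapIf (i := i) (by simp [Twin] : Twin x₂ y₂)) ht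
  simp only [fWord, precedes_append_iff, precedes_cons_iff, mem_append, mem_cons, mem_swapIf,
    h₁, h₂] at h ⊢
  exact h

theorem swapIf_x₁_y₁_sublist_fWord : swapIf i x₁ y₁ <+ fWord i j is js :=
  (sublist_append_left _ _).trans (sublist_append_right _ _)

theorem swapIf_x₂_y₂_sublist_fWord : swapIf j x₂ y₂ <+ fWord i j is js := by
  unfold fWord
  grind

theorem eq_fWord {F : List DLetter} (hd : (is ++ js).Nodup) (hF : F ~ fWord i j is js)
    (h₁ : swapIf i x₁ y₁ <+ F) (h₂ : swapIf j x₂ y₂ <+ F)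
    (h : ∀ u v, Precedes (fWord i j is js) u v → ¬ Twin u v → Precedes F u v) :
    F = fWord i j is js := by
  have hn := nodup_fWord (i := i) (j := j) hd
  refine eq_of_forall_infix_precedes (hF.nodup_iff.2 hn) hF fun u v huv => ?_
  have hvu := Precedes.asymm huv.sublist hn
  have h₁' := swapIf_x₁_y₁_sublist_fWord (i := i) (j := j) (is := is) (js := js)
  have h₂' := swapIf_x₂_y₂_sublist_fWord (i := i) (j := j) (is := is) (js := js)
  by_cases ht : Twin u v
  · rcases ht with ⟨rfl, rfl⟩ | ⟨rfl, rfl⟩ | ⟨rfl, rfl⟩ | ⟨rfl, rfl⟩ <;> cases i <;> cases j <;>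
      simp_all [swapIf]
  · exact h u v huv.sublist ht

end

/-- The substitution that deletes `x₂, y₂, p` and some of the simple letters. -/
def toLetter₁ : DLetter → List Letter
  | x₁ => [Letter.x]
  | y₁ => [Letter.y]
  | t₁ => [Letter.t]
  | a k => [Letter.z k]
  | b k => [Letter.ti k]
  | _ => []

/-- The substitution that deletes `x₁, y₁, p` and some of the simple letters. -/
def toLetter₂ : DLetter → List Letter
  | x₂ => [Letter.x]
  | y₂ => [Letter.y]
  | t₃ => [Letter.t]
  | a k => [Letter.z k]
  | b k => [Letter.ti k]
  | _ => []

variable {i j : Bool} {is js ks : List ℕ}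

theorem flatMap_toLetter₁_dWord :
    (dWord i j is js ks).flatMap toLetter₁ = baseWord i is js ks := by
  cases i <;> cases j <;>
    simp [dWord, fWord, sWord, baseWord, swapIf, pairWord, flatMap_assoc,
      toLetter₁, map_eq_flatMap]

theorem flatMap_toLetter₂_dWord :
    (dWord i j is js ks).flatMap toLetter₂ = baseWord j is js ks := by
  cases i <;> cases j <;>
    simp [dWord, fWord, sWord, baseWord, swapIf, pairWord, flatMap_assoc,
      toLetter₂, map_eq_flatMap]

theorem eq_dWord_of_sameImages (hd : (is ++ js).Nodup) (hk : ks ~ is ++ js) {w : List DLetter}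
    (h : SameImages (baseWord false is js ks) (dWord i j is js ks) w) :
    w = dWord i j is js ks := by
  have hc := hasCrossings_baseWord hk
  have hw := linearHalves_dWord (i := i) (j := j) hd hk
  obtain ⟨F, S, rfl, hF, hS⟩ := h.exists_perm hc hw
  have hsep := fun u v => exists_separator (u := u) (v := v) (i := i) (j := j) hd hk
  obtain rfl := h.right_eq_of_separated hc hw hF hS hsep fun u v huv =>
    ⟨not_twin_of_infix_sWord huv, mt Twin.symm (not_twin_of_infix_sWord huv)⟩
  obtain ⟨i', hi'⟩ := exists_swapIf_sublist (u := x₁) (v := y₁) (hF.mem_iff.2 (by simp [mem_fWord]))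
    (hF.mem_iff.2 (by simp [mem_fWord])) (by simp)
  obtain ⟨j', hj'⟩ := exists_swapIf_sublist (u := x₂) (v := y₂) (hF.mem_iff.2 (by simp [mem_fWord]))
    (hF.mem_iff.2 (by simp [mem_fWord])) (by simp)
  obtain rfl : F = fWord i' j' is js :=
    eq_fWord hd (hF.trans (fWord_perm.trans fWord_perm.symm)) hi' hj' fun u v huv ht =>
      h.precedes_left_of_separated hc hw hF hS hsep (precedes_fWord_of_not_twin ht huv) ht
  obtain rfl : i = i' :=
    SameImages.eq_of_flatMap_baseWord h flatMap_toLetter₁_dWord flatMap_toLetter₁_dWord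
  obtain rfl : j = j' :=
    SameImages.eq_of_flatMap_baseWord h flatMap_toLetter₂_dWord flatMap_toLetter₂_dWord
  rfl

end DLetter

section Flips

variable {α β : Type*} {l F S A A' B B' C C' D D' E X Y : List α} {τ e g : α} {i i' : Bool}

theorem append_inj_of_nodup (hn : (A ++ (X ++ B)).Nodup) (hX : X ≠ [])
    (h : A ++ (X ++ B) = A' ++ (X ++ B')) : A = A' ∧ B = B' := by
  obtain ⟨x, X, rfl⟩ := exists_cons_of_ne_nil hX
  rw [cons_append, nodup_middle, nodup_cons, mem_append, not_or] at hn
  obtain ⟨hA, -, hB⟩ := (append_cons_inj_of_notMem hn.1.1 hn.1.2).1 h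
  exact ⟨hA, append_cancel_left hB⟩

theorem swapIf_ne_nil : swapIf i e g ≠ [] := by
  cases i <;> simp [swapIf]

theorem swapIf_subset : swapIf i e g ⊆ e :: (C ++ g :: D) := by
  intro u hu
  rcases mem_swapIf.1 hu with rfl | rfl <;> simp

theorem eq_of_swapIf_sublist (hl : l.Nodup) (h : swapIf i e g <+ l) (h' : swapIf i' e g <+ l) :
    i = i' := by
  have := fun hle : Precedes l e g => hle.asymm hl
  cases i <;> cases i' <;> simp_all [swapIf]

namespace LinearHalves

theorem append_cons_inj (h : LinearHalves F τ S) (heq : F ++ τ :: S = A ++ τ :: B) :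
    F = A ∧ S = B := by
  obtain ⟨hA, -, hB⟩ := (append_cons_inj_of_notMem h.notMem_left h.notMem_right).1 heq
  exact ⟨hA, hB⟩

/-- As `E` is not empty, some letter of `E` occurs both in `X` and in `E`. So the first occurrence
is in the left half and the second one in the right half. -/
theorem exists_split (h : LinearHalves F τ S) (hE : E ≠ []) (hEX : E ⊆ X) (hXY : X ⊆ E ++ Y)
    (heq : F ++ τ :: S = A ++ (X ++ (B ++ (E ++ Y)))) :
    ∃ B' V, B = B' ++ τ :: V ∧ F = A ++ (X ++ B') ∧ S = V ++ (E ++ Y) := by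
  obtain ⟨e, heE⟩ := exists_mem_of_ne_nil E hE
  have heX := hEX heE
  have hτX : τ ∉ X := by
    intro hτ
    obtain ⟨X₁, X₂, rfl⟩ := append_of_mem hτ
    obtain ⟨-, rfl⟩ := h.append_cons_inj (A := A ++ X₁) (B := X₂ ++ (B ++ (E ++ Y)))
      (by simpa using heq)
    exact h.notMem_right (by simpa using .inr (.inr (by simpa using hXY hτ)))
  have hτ : τ ∈ A ++ (X ++ (B ++ (E ++ Y))) := by simp [← heq]
  simp only [mem_append, hτX, mt (@hEX τ) hτX, false_or] at hτ
  rcases hτ with hτ | hτ | hτ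
  · obtain ⟨A₁, A₂, rfl⟩ := append_of_mem hτ
    obtain ⟨-, rfl⟩ := h.append_cons_inj (A := A₁) (B := A₂ ++ (X ++ (B ++ (E ++ Y))))
      (by simpa using heq)
    have := h.nodup_right
    grind
  · obtain ⟨B', V, rfl⟩ := append_of_mem hτ
    exact ⟨B', V, rfl, h.append_cons_inj (by simpa using heq)⟩
  · obtain ⟨Y₁, Y₂, rfl⟩ := append_of_mem hτ
    obtain ⟨rfl, -⟩ := h.append_cons_inj (A := A ++ (X ++ (B ++ (E ++ Y₁)))) (B := Y₂)
      (by simpa using heq)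
    have := h.nodup_left
    grind

theorem infix_of_repeated (h : LinearHalves F τ S)
    (heq : F ++ τ :: S = A ++ (X ++ (B ++ (X ++ Y)))) : X <:+: F ∧ X <:+: S := by
  rcases eq_or_ne X [] with rfl | hX
  · simp
  · obtain ⟨B', V, -, rfl, rfl⟩ := h.exists_split hX (Subset.refl X) (subset_append_left _ _) heq
    exact ⟨⟨A, B', by simp⟩, ⟨V, Y, by simp⟩⟩

theorem exists_split_swapIf (h : LinearHalves F τ S)
    (heq : F ++ τ :: S = A ++ (swapIf i e g ++ (B ++ e :: (C ++ g :: D)))) :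
    ∃ B' V, B = B' ++ τ :: V ∧ F = A ++ (swapIf i e g ++ B') ∧ S = V ++ e :: (C ++ g :: D) :=
  h.exists_split (E := [e]) (by simp) (by simp [mem_swapIf]) swapIf_subset heq

theorem append_swapIf_inj (h : LinearHalves F τ S)
    (heq : F ++ τ :: S = A ++ (swapIf i e g ++ (B ++ e :: (C ++ g :: D))))
    (heq' : F ++ τ :: S = A' ++ (swapIf i e g ++ (B' ++ e :: (C' ++ g :: D')))) :
    A = A' ∧ B = B' ∧ C = C' ∧ D = D' := by
  obtain ⟨B₁, V, rfl, hF, hS⟩ := h.exists_split_swapIf heq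
  obtain ⟨B₁', V', rfl, hF', hS'⟩ := h.exists_split_swapIf heq'
  obtain ⟨rfl, rfl⟩ := append_inj_of_nodup (hF ▸ h.nodup_left) swapIf_ne_nil (hF.symm.trans hF')
  have hn := hS ▸ h.nodup_right
  obtain ⟨rfl, hCD⟩ := append_inj_of_nodup (X := [e]) hn (by simp) (hS.symm.trans hS')
  obtain ⟨rfl, rfl⟩ := append_inj_of_nodup (X := [g]) (nodup_cons.1 hn.of_append_right).2
    (by simp) hCD
  exact ⟨rfl, rfl, rfl, rfl⟩

end LinearHalves

theorem length_flatMap_le {f : α → List β} (h : ∀ k ∈ l, (f k).length ≤ 1) :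
    (l.flatMap f).length ≤ l.length := by
  rw [length_flatMap]
  simpa using sum_le_card_nsmul (l.map fun k => (f k).length) 1 (by simpa using h)

theorem eq_singleton_of_flatMap_eq {f : α → List α} (h : ∀ k ∈ l, (f k).length ≤ 1)
    (hl : l.flatMap f = l) : ∀ k ∈ l, f k = [k] := by
  induction l with
  | nil => simp
  | cons k l ih =>
    rw [forall_mem_cons] at h ⊢
    have hlen := length_flatMap_le h.2
    have hk : f k ≠ [] := by
      intro hk
      rw [flatMap_cons, hk, nil_append] at hl
      simp [hl] at hlen
    obtain ⟨j, hj⟩ := length_eq_one_iff.1 (le_antisymm h.1 (length_pos_iff.2 hk))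
    rw [flatMap_cons, hj, singleton_append, cons.injEq] at hl
    exact ⟨by rw [hj, hl.1], ih h.2 hl.2⟩

theorem flatMap_append_swapIf {f : α → List β} {u v : α} {u' v' : β} (hu : f u = [u'])
    (hv : f v = [v']) : (A ++ (swapIf i u v ++ (B ++ u :: (C ++ v :: D)))).flatMap f =
      A.flatMap f ++ (swapIf i u' v' ++
        (B.flatMap f ++ u' :: (C.flatMap f ++ v' :: D.flatMap f))) := by
  cases i <;> simp [swapIf, hu, hv]

theorem not_triple_sublist_of_infix {u v s : α} (hl : l.Nodup) (h : [u, v] <:+: l) :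
    ¬ [u, s, v] <+ l := by
  intro husv
  have hus : Precedes l u s := Sublist.trans (by simp) husv
  have hsv : Precedes l s v := Sublist.trans (by simp) husv
  obtain ⟨A, B, rfl⟩ := h
  simp only [precedes_append_iff, precedes_cons_iff] at hus hsv
  grind [Precedes.left_mem, Precedes.right_mem]

end Flips

namespace DLetter

variable {i j i' j' : Bool} {is js ks : List ℕ} {u v e g : DLetter} {A B C D K l r : List DLetter}
  {f : DLetter → List DLetter}

theorem twin_of_infix_fWord (hd : (is ++ js).Nodup) (hk : ks ~ is ++ js)
    (h : [u, v] <:+: fWord i j is js) (hu : u ∈ sWord ks) (hv : v ∈ sWord ks) : Twin u v := by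
  by_contra ht
  obtain ⟨s, -, hs⟩ := exists_separator hd hk hu hv h.sublist ht
  exact not_triple_sublist_of_infix (nodup_fWord hd) h hs

theorem length_le_one_of_infix (hd : (is ++ js).Nodup) (hk : ks ~ is ++ js)
    (hF : K <:+: fWord i j is js) (hS : K <:+: sWord ks) : K.length ≤ 1 := by
  rcases K with _ | ⟨u, _ | ⟨v, K⟩⟩
  · simp
  · simp
  · have huv : [u, v] <:+: u :: v :: K := (prefix_append [u, v] K).isInfix
    exact absurd
      (twin_of_infix_fWord hd hk (huv.trans hF) (hS.subset (by simp)) (hS.subset (by simp)))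
      (not_twin_of_infix_sWord (huv.trans hS))

theorem length_le_one_of_flatMap_dWord (hd : (is ++ js).Nodup) (hk : ks ~ is ++ js)
    (h : l ++ ((dWord i j is js ks).flatMap f ++ r) = dWord i' j' is js ks) (hu : u ∈ sWord ks) :
    (f u).length ≤ 1 := by
  obtain ⟨F₁, F₂, hF⟩ := append_of_mem (sWord_subset_fWord (i := i) (j := j) hk hu)
  obtain ⟨S₁, S₂, hS⟩ := append_of_mem hu
  have hw := linearHalves_dWord (i := i') (j := j') hd hk
  obtain ⟨hF', hS'⟩ := hw.infix_of_repeated (A := l ++ F₁.flatMap f) (X := f u)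
    (B := (F₂ ++ t₄ :: S₁).flatMap f) (Y := S₂.flatMap f ++ r) (by
      rw [← dWord, ← h, dWord, hF, hS]
      simp)
  exact length_le_one_of_infix hd hk hF' hS'

theorem exists_eq_singleton_of_flatMap_dWord (hd : (is ++ js).Nodup) (hk : ks ~ is ++ js)
    (h : l ++ ((dWord i j is js ks).flatMap f ++ r) = dWord i' j' is js ks) (hu : u ∈ sWord ks)
    (hfu : f u ≠ []) : ∃ e, f u = [e] :=
  length_eq_one_iff.1
    (le_antisymm (length_le_one_of_flatMap_dWord hd hk h hu) (length_pos_iff.2 hfu))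

theorem eq_of_infix_swapIf (hd : (is ++ js).Nodup) (hk : ks ~ is ++ js)
    (h : swapIf i e g <:+: fWord i' j' is js) (heg : Precedes (sWord ks) e g) :
    (i = i' ∧ e = x₁ ∧ g = y₁) ∨ (i = j' ∧ e = x₂ ∧ g = y₂) := by
  have hF := nodup_fWord (i := i') (j := j') hd
  have hS := nodup_sWord (hk.nodup_iff.2 hd)
  have ht : Twin e g := by
    cases i
    · exact twin_of_infix_fWord hd hk h heg.left_mem heg.right_mem
    · exact (twin_of_infix_fWord hd hk h heg.right_mem heg.left_mem).symm
  rcases ht with ⟨rfl, rfl⟩ | ⟨rfl, rfl⟩ | ⟨rfl, rfl⟩ | ⟨rfl, rfl⟩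
  · exact .inl ⟨eq_of_swapIf_sublist hF h.sublist swapIf_x₁_y₁_sublist_fWord, rfl, rfl⟩
  · exact absurd heg (Precedes.asymm (by simp [sWord]) hS)
  · exact .inr ⟨eq_of_swapIf_sublist hF h.sublist swapIf_x₂_y₂_sublist_fWord, rfl, rfl⟩
  · exact absurd heg (Precedes.asymm (by simp [sWord]) hS)

/-- The factor of `dWord` between the first occurrences of `x₁, y₁` and the second one of `x₁`. -/
def gap₁ (j : Bool) (js : List ℕ) : List DLetter :=
  t₁ :: p :: t₂ :: (swapIf j x₂ y₂ ++ t₃ :: (pairWord js ++ [t₄]))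

/-- The factor of `dWord` between the second occurrences of `x₁` and `y₁`. -/
def inner₁ (ks : List ℕ) : List DLetter := x₂ :: (ks.map a ++ [p, y₂])

/-- The prefix of `dWord` before the first occurrences of `x₂, y₂`. -/
def start₂ (i : Bool) (is : List ℕ) : List DLetter :=
  pairWord is ++ (swapIf i x₁ y₁ ++ [t₁, p, t₂])

/-- The factor of `dWord` between the first occurrences of `x₂, y₂` and the second one of `x₂`. -/
def gap₂ (js : List ℕ) : List DLetter := t₃ :: (pairWord js ++ [t₄, x₁])

/-- The factor of `dWord` between the second occurrences of `x₂` and `y₂`. -/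
def inner₂ (ks : List ℕ) : List DLetter := ks.map a ++ [p]

theorem dWord_eq₁ : dWord i j is js ks =
    pairWord is ++ (swapIf i x₁ y₁ ++ (gap₁ j js ++ x₁ :: (inner₁ ks ++ y₁ :: []))) := by
  simp [dWord, fWord, sWord, gap₁, inner₁]

theorem dWord_eq₂ : dWord i j is js ks =
    start₂ i is ++ (swapIf j x₂ y₂ ++ (gap₂ js ++ x₂ :: (inner₂ ks ++ y₂ :: [y₁]))) := by
  simp [dWord, fWord, sWord, start₂, gap₂, inner₂]

theorem eq_of_dWord_eq_append_swapIf (hd : (is ++ js).Nodup) (hk : ks ~ is ++ js)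
    (h : dWord i' j' is js ks = A ++ (swapIf i e g ++ (B ++ e :: (C ++ g :: D)))) :
    (i = i' ∧ e = x₁ ∧ g = y₁ ∧ pairWord is = A ∧ gap₁ j' js = B ∧ inner₁ ks = C ∧ [] = D) ∨
      (i = j' ∧ e = x₂ ∧ g = y₂ ∧ start₂ i' is = A ∧ gap₂ js = B ∧ inner₂ ks = C ∧ [y₁] = D) := by
  have hw := linearHalves_dWord (i := i') (j := j') hd hk
  obtain ⟨B', V, -, hF, hS⟩ := hw.exists_split_swapIf h
  have heg : Precedes (sWord ks) e g := by
    simp [hS]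
  rcases eq_of_infix_swapIf hd hk ⟨A, B', by rw [hF, append_assoc]⟩ heg with
    ⟨rfl, rfl, rfl⟩ | ⟨rfl, rfl, rfl⟩
  · exact .inl ⟨rfl, rfl, rfl, hw.append_swapIf_inj dWord_eq₁ h⟩
  · exact .inr ⟨rfl, rfl, rfl, hw.append_swapIf_inj dWord_eq₂ h⟩

theorem flatMap_dWord₁ (hx : f x₁ = [e]) (hy : f y₁ = [g]) :
    l ++ ((dWord i j is js ks).flatMap f ++ r) = (l ++ (pairWord is).flatMap f) ++
      (swapIf i e g ++ ((gap₁ j js).flatMap f ++ e :: ((inner₁ ks).flatMap f ++ g :: r))) := by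
  rw [dWord_eq₁, flatMap_append_swapIf hx hy]
  simp

theorem flatMap_dWord₂ (hx : f x₂ = [e]) (hy : f y₂ = [g]) :
    l ++ ((dWord i j is js ks).flatMap f ++ r) = (l ++ (start₂ i is).flatMap f) ++
      (swapIf j e g ++ ((gap₂ js).flatMap f ++
        e :: ((inner₂ ks).flatMap f ++ g :: (f y₁ ++ r)))) := by
  rw [dWord_eq₂, flatMap_append_swapIf hx hy]
  simp

theorem inner₁_subset_sWord : inner₁ ks ⊆ sWord ks := by
  unfold inner₁ sWord
  grind

theorem inner₂_subset_sWord : inner₂ ks ⊆ sWord ks := by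
  unfold inner₂ sWord
  grind

theorem swapIf_sublist_gap₁ : swapIf j x₂ y₂ <+ gap₁ j js := by
  unfold gap₁
  grind

theorem nodup_gap₁ (hjs : js.Nodup) : (gap₁ j js).Nodup := by
  cases j <;> simp [gap₁, swapIf, nodup_append, mem_pairWord, nodup_pairWord hjs] <;> grind

theorem eq_of_flatMap_gap₁_eq_gap₁ (hjs : js.Nodup) (hx : f x₂ = [x₂]) (hy : f y₂ = [y₂])
    (h : (gap₁ j js).flatMap f = gap₁ j' js) : j = j' := by
  refine eq_of_swapIf_sublist (nodup_gap₁ hjs) ?_ (swapIf_sublist_gap₁ (js := js))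
  have hfix : (swapIf j x₂ y₂).flatMap f = swapIf j x₂ y₂ := by
    cases j <;> simp [swapIf, hx, hy]
  rw [← h, ← hfix]
  exact Sublist.flatMap swapIf_sublist_gap₁ f

/-- The images of `p, x₂, y₂` and `a k` with `k ∈ js` lie in both images, so they contain none of
the letters `p` and `a k` with `k ∈ is`. There are too few other letters to produce these. -/
theorem flatMap_inner₁_ne_inner₂ (hd : (is ++ js).Nodup) (hk : ks ~ is ++ js)
    (hlen : ∀ k ∈ is, (f (a k)).length ≤ 1) (h : (gap₁ j js).flatMap f = gap₂ js) :
    (inner₁ ks).flatMap f ≠ inner₂ ks := by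
  intro hin
  have hsub : p :: is.map a ⊆ (is.map a).flatMap f := by
    intro q hq
    have hq₁ : q ∈ inner₂ ks := by
      simp only [inner₂, mem_append, mem_cons, mem_map, hk.mem_iff] at hq ⊢
      grind
    have hq₂ : q ∉ gap₂ js := by
      simp [gap₂, mem_pairWord] at hq ⊢
      grind
    rw [← hin, mem_flatMap] at hq₁
    obtain ⟨k, hk₁, hqk⟩ := hq₁
    have hk₂ : k ∉ gap₁ j js := fun hk₂ => hq₂ (h ▸ mem_flatMap_of_mem hk₂ hqk)
    refine mem_flatMap.2 ⟨k, ?_, hqk⟩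
    simp only [inner₁, gap₁, mem_append, mem_cons, mem_map, hk.mem_iff, mem_swapIf,
      mem_pairWord] at hk₁ hk₂ ⊢
    grind
  have hnodup : (p :: is.map a).Nodup := by
    simpa using hd.of_append_left.map (f := a) fun _ _ h => by injection h
  have hle := (hnodup.subperm hsub).length_le.trans (length_flatMap_le (by simpa using hlen))
  simp at hle

theorem flip₁_of_ne_nil (hd : (is ++ js).Nodup) (hk : ks ~ is ++ js)
    (hx : f x₁ ≠ []) (hy : f y₁ ≠ [])
    (h : l ++ ((dWord i j is js ks).flatMap f ++ r) = dWord i' j' is js ks) :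
    j = j' ∧ l ++ ((dWord (!i) j is js ks).flatMap f ++ r) = dWord (!i') j' is js ks := by
  have hlen := fun u => length_le_one_of_flatMap_dWord (u := u) hd hk h
  obtain ⟨e, he⟩ := exists_eq_singleton_of_flatMap_dWord hd hk h (by simp [mem_sWord]) hx
  obtain ⟨g, hg⟩ := exists_eq_singleton_of_flatMap_dWord hd hk h (by simp [mem_sWord]) hy
  rw [flatMap_dWord₁ he hg] at h ⊢
  rcases eq_of_dWord_eq_append_swapIf hd hk h.symm with
    ⟨rfl, rfl, rfl, hA, hB, hC, rfl⟩ | ⟨-, -, -, -, hB, hC, -⟩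
  · have hfix := eq_singleton_of_flatMap_eq (fun u hu => hlen u (inner₁_subset_sWord hu)) hC.symm
    refine ⟨eq_of_flatMap_gap₁_eq_gap₁ hd.of_append_right (hfix x₂ (by simp [inner₁]))
      (hfix y₂ (by simp [inner₁])) hB.symm, ?_⟩
    rw [← hA, ← hB, ← hC, dWord_eq₁]
  · refine absurd hC.symm (flatMap_inner₁_ne_inner₂ hd hk (fun k hk' => hlen _ ?_) hB.symm)
    simp [mem_sWord, hk.mem_iff, hk']

theorem flip₂_of_ne_nil (hd : (is ++ js).Nodup) (hk : ks ~ is ++ js)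
    (hx : f x₂ ≠ []) (hy : f y₂ ≠ [])
    (h : l ++ ((dWord i j is js ks).flatMap f ++ r) = dWord i' j' is js ks) :
    l ++ ((dWord i (!j) is js ks).flatMap f ++ r) = dWord i' (!j') is js ks := by
  have hlen := fun u => length_le_one_of_flatMap_dWord (u := u) hd hk h
  obtain ⟨e, he⟩ := exists_eq_singleton_of_flatMap_dWord hd hk h (by simp [mem_sWord]) hx
  obtain ⟨g, hg⟩ := exists_eq_singleton_of_flatMap_dWord hd hk h (by simp [mem_sWord]) hy
  rw [flatMap_dWord₂ he hg] at h ⊢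
  rcases eq_of_dWord_eq_append_swapIf hd hk h.symm with
    ⟨-, -, -, -, -, hC, -⟩ | ⟨rfl, rfl, rfl, hA, hB, hC, hD⟩
  · have hle := length_flatMap_le fun u hu => hlen u (inner₂_subset_sWord hu)
    rw [← hC] at hle
    simp [inner₁, inner₂] at hle
  · rw [← hA, ← hB, ← hC, ← hD, dWord_eq₂]

theorem flip₁ (hd : (is ++ js).Nodup) (hk : ks ~ is ++ js)
    (h : l ++ ((dWord i j is js ks).flatMap f ++ r) = dWord i' j' is js ks) :
    l ++ ((dWord (!i) j is js ks).flatMap f ++ r) = dWord i' j' is js ks ∨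
      j = j' ∧ l ++ ((dWord (!i) j is js ks).flatMap f ++ r) = dWord (!i') j' is js ks := by
  by_cases hf : f x₁ = [] ∨ f y₁ = []
  · have hflip : (dWord (!i) j is js ks).flatMap f = (dWord i j is js ks).flatMap f := by
      rcases hf with hf | hf <;> cases i <;> simp [dWord, fWord, swapIf, hf]
    exact .inl (by rw [hflip, h])
  · rw [not_or] at hf
    exact .inr (flip₁_of_ne_nil hd hk hf.1 hf.2 h)

theorem flip₂ (hd : (is ++ js).Nodup) (hk : ks ~ is ++ js)
    (h : l ++ ((dWord i j is js ks).flatMap f ++ r) = dWord i' j' is js ks) :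
    l ++ ((dWord i (!j) is js ks).flatMap f ++ r) = dWord i' j' is js ks ∨
      l ++ ((dWord i (!j) is js ks).flatMap f ++ r) = dWord i' (!j') is js ks := by
  by_cases hf : f x₂ = [] ∨ f y₂ = []
  · have hflip : (dWord i (!j) is js ks).flatMap f = (dWord i j is js ks).flatMap f := by
      rcases hf with hf | hf <;> cases j <;> simp [dWord, fWord, swapIf, hf]
    exact .inl (by rw [hflip, h])
  · rw [not_or] at hf
    exact .inr (flip₂_of_ne_nil hd hk hf.1 hf.2 h)

end DLetter

namespace MonoidVariety

theorem satisfies_syntacticMonoid_of_flip {X : Type} {w : Bool → List X} {T : Set (FreeMonoid X)}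
    (h : ∀ (i : Bool) (f : X → List X) (l r : List X),
      FreeMonoid.ofList (l ++ ((w i).flatMap f ++ r)) ∈ T →
        FreeMonoid.ofList (l ++ ((w !i).flatMap f ++ r)) ∈ T) :
    Satisfies (SyntacticMonoid T) (FreeMonoid.ofList (w false)) (FreeMonoid.ofList (w true)) := by
  refine satisfies_syntacticMonoid fun φ l r => ?_
  obtain ⟨f, rfl⟩ := FreeMonoid.lift.surjective φ
  have hcontext : ∀ u : List X, l * FreeMonoid.lift f (FreeMonoid.ofList u) * r =
      FreeMonoid.ofList (l.toList ++ (u.flatMap (fun k => (f k).toList) ++ r.toList)) := by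
    intro u
    apply FreeMonoid.toList.injective
    simp [FreeMonoid.lift_apply, FreeMonoid.toList_prod, Function.comp_def, flatMap_def]
  rw [hcontext, hcontext]
  exact ⟨h false _ _ _, h true _ _ _⟩

end MonoidVariety

namespace DLetter

open MonoidVariety

variable {is js ks : List ℕ}

theorem injective2_dWord : Function.Injective2 fun i j => dWord i j is js ks := by
  intro i i' j j' h
  constructor
  · have := congrArg (List.flatMap toLetter₁) h
    exact baseWord_inj (by simpa only [flatMap_toLetter₁_dWord] using this)
  · have := congrArg (List.flatMap toLetter₂) h
    exact baseWord_inj (by simpa only [flatMap_toLetter₂_dWord] using this)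

theorem isIsoterm_dWord (hd : (is ++ js).Nodup) (hk : ks ~ is ++ js) (i j : Bool) :
    IsIsoterm (FactorMonoid (baseWord false is js ks)) (FreeMonoid.ofList (dWord i j is js ks)) :=
  fun _ h => eq_dWord_of_sameImages hd hk h.sameImages

theorem satisfies_flip₁ (hd : (is ++ js).Nodup) (hk : ks ~ is ++ js) (j j' : Bool) :
    Satisfies (SyntacticMonoid {FreeMonoid.ofList (dWord false j' is js ks),
      FreeMonoid.ofList (dWord true j' is js ks)})
      (FreeMonoid.ofList (dWord false j is js ks)) (FreeMonoid.ofList (dWord true j is js ks)) := by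
  refine satisfies_syntacticMonoid_of_flip (w := fun i => dWord i j is js ks) fun i f l r h => ?_
  rcases h with h | h
  · exact (flip₁ hd hk h).imp id And.right
  · exact ((flip₁ hd hk h).imp id And.right).symm

theorem satisfies_flip₂ (hd : (is ++ js).Nodup) (hk : ks ~ is ++ js) (i i' : Bool) :
    Satisfies (SyntacticMonoid {FreeMonoid.ofList (dWord i' false is js ks),
      FreeMonoid.ofList (dWord i' true is js ks)})
      (FreeMonoid.ofList (dWord i false is js ks)) (FreeMonoid.ofList (dWord i true is js ks)) := by
  refine satisfies_syntacticMonoid_of_flip (w := fun j => dWord i j is js ks) fun j f l r h => ?_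
  rcases h with h | h
  · exact flip₂ hd hk h
  · exact (flip₂ hd hk h).symm

theorem satisfies_flip₁_of_ne (hd : (is ++ js).Nodup) (hk : ks ~ is ++ js) {j j' : Bool}
    (hj : j ≠ j') (i : Bool) :
    Satisfies (SyntacticMonoid {FreeMonoid.ofList (dWord i j' is js ks)})
      (FreeMonoid.ofList (dWord false j is js ks)) (FreeMonoid.ofList (dWord true j is js ks)) :=
  satisfies_syntacticMonoid_of_flip (w := fun i => dWord i j is js ks) fun _ _ _ _ h =>
    (flip₁ hd hk h).resolve_right fun h => hj h.1

end DLetter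

theorem not_isModularLattice_generatedBy_baseWord {is js ks : List ℕ} (hd : (is ++ js).Nodup)
    (hk : ks ~ is ++ js) : ¬ IsModularLattice
      (MonoidVariety.generatedBy (FactorMonoid (baseWord false is js ks))).SubvarietyLattice := by
  have hmem : ∀ T : Set (FreeMonoid DLetter),
      (∀ w ∈ T, ∃ i j, w = FreeMonoid.ofList (DLetter.dWord i j is js ks)) →
      MonCat.of (MonoidVariety.SyntacticMonoid T) ∈
        (MonoidVariety.generatedBy (FactorMonoid (baseWord false is js ks))).carrier := by
    refine fun T hT => MonoidVariety.syntacticMonoid_mem_generatedBy fun w hw => ?_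
    obtain ⟨i, j, rfl⟩ := hT w hw
    exact DLetter.isIsoterm_dWord hd hk i j
  exact MonoidVariety.not_isModularLattice_of_square
    (w := fun i j => FreeMonoid.ofList (DLetter.dWord i j is js ks)) DLetter.injective2_dWord
    (hmem _ (by grind)) (hmem _ (by grind))
    (fun j => DLetter.satisfies_flip₁ hd hk j false)
    (fun i => DLetter.satisfies_flip₂ hd hk i false)
    (DLetter.satisfies_flip₁_of_ne hd hk (by decide) false)

theorem mainTheorem5 (n m : ℕ) (ρ : Equiv.Perm (Fin (n + m))) :
    ¬ IsModularLattice
        (MonoidVariety.generatedBy (FactorMonoid (cWord n m 0 ρ))).SubvarietyLattice ∧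
      ¬ ∀ A B C : (MonoidVariety.generatedBy (FactorMonoid (cWord n m 0 ρ))).SubvarietyLattice,
          A ⊓ (B ⊔ C) = (A ⊓ B) ⊔ (A ⊓ C) := by
  have hmod : ¬ IsModularLattice
      (MonoidVariety.generatedBy (FactorMonoid (cWord n m 0 ρ))).SubvarietyLattice := by
    rw [cWord_zero]
    exact not_isModularLattice_generatedBy_baseWord (nodup_range_append_range' n m)
      (map_val_finRange_perm ρ)
  exact ⟨hmod, fun h => hmod (isModularLattice_of_inf_sup_left h)⟩
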